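/- A partition of $[n]=\{1,\dots,n\}$ is written as $\Pi=B_1/B_2/\cdots$ with its blocks ordered so that $\min B_1<\min B_2<\cdots$, and is represented by its canonical sequential form $\pi=\pi_1\pi_2\cdots\pi_n$, where $j\in B_{\pi_j}$ for $1\le j\le n$. Such a partition contains a pattern $\tau=\tau_1\cdots\tau_m$ if $\pi$ has a subsequence (not necessarily contiguous) that is order-isomorphic to $\tau$; otherwise it avoids $\tau$. For $n\ge 0$ let $p_n(1123,1211)$ be the number of partitions of $[n]$ that avoid both $1123$ and $1211$ (for $n=0$ there is exactly one partition, the empty one). Theorem. As an identity of formal Laurent series in $t$ over $\mathbb{Q}$, \[ \sum_{n\ge 0}p_n(1123,1211)\,t^n=\frac{(1-t^2)\sqrt{(1-t)(1-t-4t^2)}}{2t^2(1-3t+t^2)}-\frac{1-3t-2t^2+14t^3-15t^4+3t^5}{2t^2(1-t)^2(1-3t+t^2)}, \] where $\sqrt{(1-t)(1-t-4t^2)}$ denotes the unique formal power series with constant term $1$ whose square is $(1-t)(1-t-4t^2)$. -/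

import Mathlib

open scoped PowerSeries LaurentSeries

/-- The canonical sequential form `π₁π₂⋯πₙ` of a partition `P` of an `n`-element linearly ordered
ground set (here `Fin n`).  If the blocks are listed as `B₁, B₂, …` with
`min B₁ < min B₂ < ⋯`, then the letter at `j` is the index (starting from `1`) of the block that
contains `j`, that is, the number of blocks whose minimum is at most the minimum of the block
of `j`. -/
def canonicalWord {n : ℕ} (P : Finpartition (Finset.univ : Finset (Fin n))) (j : Fin n) : ℕ :=
  (P.parts.filter fun B => B.min ≤ (P.part j).min).card

/-- The word `w` has a subsequence that is order-isomorphic to the word `τ`. -/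
def ContainsPattern {n : ℕ} (w : Fin n → ℕ) (τ : List ℕ) : Prop :=
  ∃ f : Fin τ.length → Fin n, StrictMono f ∧
    ∀ i j, (w (f i) < w (f j) ↔ τ.get i < τ.get j) ∧ (w (f i) > w (f j) ↔ τ.get i > τ.get j)

/-- The number of set partitions of an `n`-element linearly ordered set whose canonical
sequential form avoids every pattern in `T`. -/
noncomputable def avoidCount (T : Set (List ℕ)) (n : ℕ) : ℕ :=
  Nat.card {P : Finpartition (Finset.univ : Finset (Fin n)) //
    ∀ τ ∈ T, ¬ ContainsPattern (canonicalWord P) τ}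

/-- The ordinary generating function `∑ₙ pₙ(T) Xⁿ`, as a formal power series. -/
noncomputable def avoidGF (T : Set (List ℕ)) : ℚ⟦X⟧ :=
  PowerSeries.mk fun n => (avoidCount T n : ℚ)

/-! ### Counting the words of a language by length -/

/-! Canonical sequential forms are exactly the restricted growth words, so the task is to count such
words without 1123 or 1211. Let 12⋯k be the longest initial run of new letters. Once a letter a ≤ k
follows, no letter exceeds k+1, since k+1 would precede it and give a a (k+1) x. Because every
letter ≤ k already occurs in the prefix, avoidance then says exactly that the tail avoids 123, that
letters below k do not repeat in it, and that k+1, k, k is not a subsequence (`Continuation.tail`,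
`Tail.continuation`).

The tail is counted letter by letter. Below the top one or two letters, only two sizes matter: p
letters of A, smaller than everything read from A so far, and q letters of B, each exceeding an
earlier letter, so that nothing larger may follow it. Reading from A keeps its smaller letters and
moves its larger ones to B; reading from B erases everything larger in B and the top letters. This
gives `bareCount`, `toppedCount` and `twoCount`.

Marking both word length and p by X gives, for each q, a series D_q, together with diagonal sums E_q
= D_q + X E_{q+1}. The system is solved by D_q proportional to (1 + Xg)^q, where X²g² = (1 - X)(g -
1), that is, g is the Catalan series at X²/(1 - X). Contraction in the X-adic topology
(`eq_zero_of_recurrence`) makes the solution unique. The quadratic formula gives the square root as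
1 - X - 2X²g, and clearing 1 - Xg produces 1 - 3X + X², since g = 1/X solves the quadratic exactly
when (1 - X)² = X. -/

/-- The language `W` has exactly `c` words of length `n`. -/
def Counts (W : List ℕ → Prop) (n c : ℕ) : Prop :=
  ∃ s : Finset (List ℕ), (∀ L, L ∈ s ↔ L.length = n ∧ W L) ∧ s.card = c

theorem Counts.congr {W W' : List ℕ → Prop} {n c : ℕ} (h : Counts W n c)
    (hW : ∀ L, W' L ↔ W L) : Counts W' n c := by
  rwa [show W' = W from funext fun L => propext (hW L)]

theorem Counts.zero {W : List ℕ → Prop} (h : W []) : Counts W 0 1 := by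
  refine ⟨{[]}, fun L => ?_, by simp⟩
  rw [Finset.mem_singleton, List.length_eq_zero_iff]
  exact ⟨fun hL => ⟨hL, hL ▸ h⟩, fun hL => hL.1⟩

/-- Words with different first letters are distinct, so the residual languages contribute
disjointly. Finiteness is carried along by the explicit finset. -/
theorem Counts.succ {W : List ℕ → Prop} {n : ℕ} {s : Finset ℕ} {c : ℕ → ℕ}
    (hs : ∀ a L, W (a :: L) → a ∈ s)
    (h : ∀ a ∈ s, Counts (fun L => W (a :: L)) n (c a)) :
    Counts W (n + 1) (∑ a ∈ s, c a) := by
  classical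
  choose! f hf hc using h
  refine ⟨s.biUnion fun a => (f a).image (List.cons a), fun L => ?_, ?_⟩
  · simp only [Finset.mem_biUnion, Finset.mem_image]
    constructor
    · rintro ⟨a, ha, L', hL', rfl⟩
      have := (hf a ha L').1 hL'
      exact ⟨by simp [this.1], this.2⟩
    · rintro ⟨hl, hW⟩
      cases L with
      | nil => simp at hl
      | cons a L =>
        exact ⟨a, hs a L hW, L, (hf a (hs a L hW) L).2 ⟨by simpa using hl, hW⟩, rfl⟩
  · rw [Finset.card_biUnion]
    · refine Finset.sum_congr rfl fun a ha => ?_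
      rw [Finset.card_image_of_injective _ (List.cons_injective), hc a ha]
    · intro a _ b _ hab
      rw [Function.onFun, Finset.disjoint_left]
      intro L hL hL'
      simp only [Finset.mem_image] at hL hL'
      obtain ⟨_, _, rfl⟩ := hL
      obtain ⟨_, _, h⟩ := hL'
      exact hab (List.cons.inj h).1.symm

/-- The i-th smallest element has i elements below and `A.card - 1 - i` above. This turns sums over
letters into recurrences that see only the sizes of the alphabets. -/
theorem sum_card_filter_lt_gt (A : Finset ℕ) (f : ℕ → ℕ → ℕ) :
    ∑ a ∈ A, f (A.filter (· < a)).card (A.filter (a < ·)).card =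
      ∑ i ∈ Finset.range A.card, f i (A.card - 1 - i) := by
  induction A using Finset.induction_on_max generalizing f with
  | empty => simp
  | insert m A hm ih =>
    have hmA : m ∉ A := fun h => lt_irrefl _ (hm m h)
    rw [Finset.sum_insert hmA, Finset.card_insert_of_notMem hmA, Finset.sum_range_succ, add_comm]
    congr 1
    · have e : ∀ a ∈ A, f ((insert m A).filter (· < a)).card ((insert m A).filter (a < ·)).card =
          f (A.filter (· < a)).card ((A.filter (a < ·)).card + 1) := by
        intro a ha
        rw [Finset.filter_insert, Finset.filter_insert, if_neg (hm a ha).not_gt, if_pos (hm a ha),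
          Finset.card_insert_of_notMem (by simp [hmA])]
      rw [Finset.sum_congr rfl e, ih fun i j => f i (j + 1)]
      refine Finset.sum_congr rfl fun i hi => ?_
      rw [Finset.mem_range] at hi
      congr 1
      omega
    · rw [Finset.filter_insert, Finset.filter_insert, if_neg (lt_irrefl m), if_neg (lt_irrefl m),
        Finset.filter_true_of_mem hm, Finset.filter_false_of_mem fun a ha => (hm a ha).not_gt]
      simp

theorem sum_card_filter_lt (A : Finset ℕ) (f : ℕ → ℕ) :
    ∑ a ∈ A, f (A.filter (· < a)).card = ∑ i ∈ Finset.range A.card, f i :=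
  sum_card_filter_lt_gt A fun i _ => f i

/-! ### Residual languages -/

/-- The word has no strictly increasing subsequence of length three. -/
def Avoids123 : List ℕ → Prop
  | [] => True
  | a :: L => L.Pairwise (fun x y => a < x → y ≤ x) ∧ Avoids123 L

/-- Words that avoid `123` over the alphabet `A ∪ B ∪ T`, in which letters of `A ∪ B` do not
repeat and no letter of `B` is followed by a larger letter. -/
def Residual (A B T : Finset ℕ) (L : List ℕ) : Prop :=
  (∀ x ∈ L, x ∈ A ∨ x ∈ B ∨ x ∈ T) ∧ Avoids123 L ∧
    L.Pairwise fun x y => (x ∈ A → y ≠ x) ∧ (x ∈ B → y < x)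

/-- After the letter `k + 1` the letter `k` occurs at most once. -/
def LateOnce (k : ℕ) : List ℕ → Prop
  | [] => True
  | a :: L => (a = k + 1 → L.Pairwise fun x y => x = k → y ≠ k) ∧ LateOnce k L

/-- As `Residual A B {k, k + 1}`, where moreover `k` is not followed by `k + 1` and occurs at most
once after an occurrence of `k + 1`. -/
def ResidualTwo (k : ℕ) (A B : Finset ℕ) (L : List ℕ) : Prop :=
  (∀ x ∈ L, x ∈ A ∨ x ∈ B ∨ x = k ∨ x = k + 1) ∧ Avoids123 L ∧ LateOnce k L ∧
    L.Pairwise fun x y => (x ∈ A → y ≠ x) ∧ (x ∈ B → y < x) ∧ (x = k → y ≤ k)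

/-- The words that may follow `12⋯k` in a pattern-avoiding word, except for the restriction on the
first letter. -/
def Tail (k : ℕ) (L : List ℕ) : Prop :=
  (∀ x ∈ L, 1 ≤ x ∧ x ≤ k + 1) ∧ Avoids123 L ∧ LateOnce k L ∧ L.Pairwise fun x y => x < k → y ≠ x

/-! ### Transitions on reading one letter -/

theorem lateOnce_of_not_mem {k : ℕ} {L : List ℕ} (h : k + 1 ∉ L) : LateOnce k L := by
  induction L with
  | nil => trivial
  | cons a L ih =>
    simp only [List.mem_cons, not_or] at h
    exact ⟨fun e => absurd e.symm h.1, ih h.2⟩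

theorem lateOnce_of_pairwise {k : ℕ} {L : List ℕ} (h : L.Pairwise fun x y => x = k → y ≠ k) :
    LateOnce k L := by
  induction L with
  | nil => trivial
  | cons a L ih =>
    rw [List.pairwise_cons] at h
    exact ⟨fun _ => h.2, ih h.2⟩

/-- After `a`, a letter above `a` cannot be followed by anything larger, as that would complete 123;
so the part of `A` above `a` passes into the second alphabet. -/
theorem residual_cons_low {A B T : Finset ℕ} {a : ℕ} {L : List ℕ}
    (hAB : ∀ x ∈ A, ∀ y ∈ B, x < y) (hT : ∀ x ∈ T, ∀ y, y ∈ A ∨ y ∈ B ∨ y ∈ T → y ≤ x)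
    (hT' : ∀ x ∈ T, x ∉ A ∧ x ∉ B) (ha : a ∈ A) :
    Residual A B T (a :: L) ↔
      Residual (A.filter (· < a)) (B ∪ A.filter (a < ·)) T L := by
  have haB : a ∉ B := fun h => lt_irrefl _ (hAB a ha a h)
  simp only [Residual, Avoids123, List.pairwise_cons, List.forall_mem_cons, Finset.mem_filter,
    Finset.mem_union]
  constructor
  · rintro ⟨⟨-, h1⟩, ⟨h2, h3⟩, h4, h5⟩
    refine ⟨fun x hx => ?_, h3, ?_⟩
    · have := (h4 x hx).1 ha
      have := h1 x hx
      grind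
    · refine (h2.and h5).imp ?_
      grind
  · rintro ⟨h1, h2, h3⟩
    refine ⟨⟨Or.inl ha, fun x hx => ?_⟩, ⟨?_, h2⟩, fun x hx => ⟨fun _ => ?_, fun h => absurd h haB⟩, ?_⟩
    · have := h1 x hx
      grind
    · refine h3.imp_of_mem ?_
      intro x y hx hy h hax
      have := h1 x hx
      have := h1 y hy
      grind
    · have := h1 x hx
      grind
    · refine h3.imp_of_mem ?_
      intro x y hx hy h
      have := h1 x hx
      have := h1 y hy
      grind

theorem avoids123_cons_max {a : ℕ} {L : List ℕ} (h : ∀ x ∈ L, x ≤ a) :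
    Avoids123 (a :: L) ↔ Avoids123 L :=
  and_iff_right <| List.pairwise_of_forall_mem_list fun x hx _ _ hax =>
    absurd (h x hx) hax.not_ge

theorem residual_cons_mid {A B T : Finset ℕ} {a : ℕ} {L : List ℕ}
    (hAB : ∀ x ∈ A, ∀ y ∈ B, x < y) (hT : ∀ x ∈ T, ∀ y ∈ B, y < x) (ha : a ∈ B) :
    Residual A B T (a :: L) ↔ Residual A (B.filter (· < a)) ∅ L := by
  have haA : a ∉ A := fun h => lt_irrefl _ (hAB a h a ha)
  simp only [Residual, List.pairwise_cons, List.forall_mem_cons, Finset.mem_filter,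
    Finset.notMem_empty, or_false]
  constructor
  · rintro ⟨⟨-, h1⟩, h2, h4, h5⟩
    have hlt : ∀ x ∈ L, x < a := fun x hx => (h4 x hx).2 ha
    rw [avoids123_cons_max fun x hx => (hlt x hx).le] at h2
    refine ⟨fun x hx => ?_, h2, h5.imp ?_⟩
    · have := h1 x hx
      have := hlt x hx
      grind
    · grind
  · rintro ⟨h1, h2, h3⟩
    have hlt : ∀ x ∈ L, x < a := fun x hx => by
      have := h1 x hx
      grind
    rw [avoids123_cons_max fun x hx => (hlt x hx).le]
    refine ⟨⟨Or.inr (Or.inl ha), fun x hx => ?_⟩, h2,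
      fun x hx => ⟨fun h => absurd h haA, fun _ => hlt x hx⟩, h3.imp_of_mem ?_⟩
    · have := h1 x hx
      grind
    · intro x y hx hy h
      have := hlt x hx
      grind

/-- A top letter is a maximum of the alphabet: it starts no 123 and may repeat, so it leaves the
state unchanged. -/
theorem residual_cons_top {A B T : Finset ℕ} {a : ℕ} {L : List ℕ}
    (hT : ∀ x ∈ T, ∀ y, y ∈ A ∨ y ∈ B ∨ y ∈ T → y ≤ x)
    (hT' : ∀ x ∈ T, x ∉ A ∧ x ∉ B) (ha : a ∈ T) :
    Residual A B T (a :: L) ↔ Residual A B T L := by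
  simp only [Residual, List.pairwise_cons, List.forall_mem_cons]
  constructor
  · rintro ⟨⟨-, h1⟩, h2, h4, h5⟩
    exact ⟨h1, h2.2, h5⟩
  · rintro ⟨h1, h2, h3⟩
    rw [avoids123_cons_max fun x hx => hT a ha x (h1 x hx)]
    exact ⟨⟨Or.inr (Or.inr ha), h1⟩, h2,
      fun x _ => ⟨fun h => absurd h (hT' a ha).1, fun h => absurd h (hT' a ha).2⟩, h3⟩

theorem residualTwo_cons_low {k : ℕ} {A B : Finset ℕ} {a : ℕ} {L : List ℕ}
    (hAB : ∀ x ∈ A, ∀ y ∈ B, x < y) (hA : ∀ x ∈ A, x < k) (hB : ∀ x ∈ B, x < k) (ha : a ∈ A) :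
    ResidualTwo k A B (a :: L) ↔
      ResidualTwo k (A.filter (· < a)) (B ∪ A.filter (a < ·)) L := by
  have haB : a ∉ B := fun h => lt_irrefl _ (hAB a ha a h)
  have hak := hA a ha
  simp only [ResidualTwo, Avoids123, LateOnce, List.pairwise_cons, List.forall_mem_cons,
    Finset.mem_filter, Finset.mem_union]
  constructor
  · rintro ⟨⟨-, h1⟩, ⟨h2, h3⟩, h6, h4, h5⟩
    refine ⟨fun x hx => ?_, h3, h6.2, ?_⟩
    · have := (h4 x hx).1 ha
      have := h1 x hx
      grind
    · refine (h2.and h5).imp ?_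
      grind
  · rintro ⟨h1, h2, h6, h3⟩
    refine ⟨⟨Or.inl ha, fun x hx => ?_⟩, ⟨?_, h2⟩, ⟨by omega, h6⟩,
      fun x hx => ⟨fun _ => ?_, fun h => absurd h haB, by omega⟩, ?_⟩
    · have := h1 x hx
      grind
    · refine h3.imp_of_mem ?_
      intro x y hx hy h hax
      have := h1 x hx
      have := h1 y hy
      grind
    · have := h1 x hx
      grind
    · refine h3.imp_of_mem ?_
      intro x y hx hy h
      have := h1 x hx
      have := h1 y hy
      grind

theorem residualTwo_cons_mid {k : ℕ} {A B : Finset ℕ} {a : ℕ} {L : List ℕ}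
    (hAB : ∀ x ∈ A, ∀ y ∈ B, x < y) (hB : ∀ x ∈ B, x < k) (ha : a ∈ B) :
    ResidualTwo k A B (a :: L) ↔ Residual A (B.filter (· < a)) ∅ L := by
  have haA : a ∉ A := fun h => lt_irrefl _ (hAB a h a ha)
  have hak := hB a ha
  simp only [ResidualTwo, Residual, LateOnce, List.pairwise_cons, List.forall_mem_cons,
    Finset.mem_filter, Finset.notMem_empty, or_false]
  constructor
  · rintro ⟨⟨-, h1⟩, h2, -, h4, h5⟩
    have hlt : ∀ x ∈ L, x < a := fun x hx => (h4 x hx).2.1 ha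
    rw [avoids123_cons_max fun x hx => (hlt x hx).le] at h2
    refine ⟨fun x hx => ?_, h2, h5.imp ?_⟩
    · have := h1 x hx
      have := hlt x hx
      grind
    · grind
  · rintro ⟨h1, h2, h3⟩
    have hlt : ∀ x ∈ L, x < a := fun x hx => by
      have := h1 x hx
      grind
    rw [avoids123_cons_max fun x hx => (hlt x hx).le]
    refine ⟨⟨Or.inr (Or.inl ha), fun x hx => ?_⟩, h2,
      ⟨by omega, lateOnce_of_not_mem fun h => ?_⟩,
      fun x hx => ⟨fun h => absurd h haA, fun _ => hlt x hx, by omega⟩, h3.imp_of_mem ?_⟩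
    · have := h1 x hx
      grind
    · have := hlt _ h
      omega
    · intro x y hx hy h
      have := hlt x hx
      grind

/-- Reading `k` excludes `k + 1` from then on, so `k` becomes the single freely repeating top
letter. -/
theorem residualTwo_cons_self {k : ℕ} {A B : Finset ℕ} {L : List ℕ}
    (hA : ∀ x ∈ A, x < k) (hB : ∀ x ∈ B, x < k) :
    ResidualTwo k A B (k :: L) ↔ Residual A B {k} L := by
  have hkA : k ∉ A := fun h => lt_irrefl _ (hA k h)
  have hkB : k ∉ B := fun h => lt_irrefl _ (hB k h)
  simp only [ResidualTwo, Residual, LateOnce, List.pairwise_cons, List.forall_mem_cons,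
    Finset.mem_singleton]
  constructor
  · rintro ⟨⟨-, h1⟩, h2, -, h4, h5⟩
    refine ⟨fun x hx => ?_, h2.2, h5.imp fun h => ⟨h.1, h.2.1⟩⟩
    have := h1 x hx
    have := h4 x hx
    grind
  · rintro ⟨h1, h2, h3⟩
    have hle : ∀ x ∈ L, x ≤ k := fun x hx => by
      have := h1 x hx
      grind
    rw [avoids123_cons_max hle]
    refine ⟨⟨by simp, fun x hx => ?_⟩, h2, ⟨by omega, lateOnce_of_not_mem fun h => ?_⟩,
      fun x hx => ⟨fun h => absurd h hkA, fun h => absurd h hkB, fun _ => hle x hx⟩,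
      h3.imp_of_mem fun hx hy h => ⟨h.1, h.2, fun _ => hle _ hy⟩⟩
    · have := h1 x hx
      grind
    · have := hle _ h
      omega

/-- Once `k + 1` is read, `k` may occur only once more and never before another `k + 1`: exactly the
rule for a letter of the second alphabet. -/
theorem residualTwo_cons_succ {k : ℕ} {A B : Finset ℕ} {L : List ℕ}
    (hA : ∀ x ∈ A, x < k) (hB : ∀ x ∈ B, x < k) :
    ResidualTwo k A B ((k + 1) :: L) ↔ Residual A (insert k B) {k + 1} L := by
  have hkA : k ∉ A := fun h => lt_irrefl _ (hA k h)
  have hkB : k ∉ B := fun h => lt_irrefl _ (hB k h)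
  have hkA' : k + 1 ∉ A := fun h => absurd (hA _ h) (by omega)
  have hkB' : k + 1 ∉ B := fun h => absurd (hB _ h) (by omega)
  simp only [ResidualTwo, Residual, LateOnce, List.pairwise_cons, List.forall_mem_cons,
    Finset.mem_singleton, Finset.mem_insert]
  constructor
  · rintro ⟨⟨-, h1⟩, h2, h6, h4, h5⟩
    refine ⟨fun x hx => ?_, h2.2, ((h6.1 trivial).and h5).imp ?_⟩
    · have := h1 x hx
      grind
    · grind
  · rintro ⟨h1, h2, h3⟩
    have hle : ∀ x ∈ L, x ≤ k + 1 := fun x hx => by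
      have := h1 x hx
      grind
    rw [avoids123_cons_max hle]
    have hp : L.Pairwise fun x y => x = k → y ≠ k := h3.imp (by grind)
    refine ⟨⟨by simp, fun x hx => ?_⟩, h2, ⟨fun _ => hp, lateOnce_of_pairwise hp⟩,
      fun x hx => ⟨fun h => absurd h hkA', fun h => absurd h hkB', by omega⟩, h3.imp (by grind)⟩
    have := h1 x hx
    grind

theorem tail_cons_low {k a : ℕ} {L : List ℕ} (ha : 1 ≤ a) (hak : a < k) :
    Tail k (a :: L) ↔ ResidualTwo k (Finset.Ico 1 a) (Finset.Ioo a k) L := by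
  simp only [Tail, ResidualTwo, Avoids123, LateOnce, List.pairwise_cons, List.forall_mem_cons,
    Finset.mem_Ico, Finset.mem_Ioo]
  constructor
  · rintro ⟨⟨-, h1⟩, ⟨h2, h3⟩, h6, h4, h5⟩
    refine ⟨fun x hx => ?_, h3, h6.2, (h2.and h5).imp ?_⟩
    · have := (h4 x hx) hak
      have := h1 x hx
      omega
    · grind
  · rintro ⟨h1, h2, h6, h3⟩
    refine ⟨⟨by omega, fun x hx => ?_⟩, ⟨h3.imp_of_mem ?_, h2⟩, ⟨by omega, h6⟩,
      fun x hx _ => ?_, h3.imp_of_mem ?_⟩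
    · have := h1 x hx
      omega
    · intro x y hx hy h hax
      have := h1 x hx
      have := h1 y hy
      grind
    · have := h1 x hx
      omega
    · intro x y hx hy h
      have := h1 x hx
      grind

theorem tail_cons_self {k : ℕ} {L : List ℕ} (hk : 1 ≤ k) : Tail k (k :: L) ↔ Tail k L := by
  simp only [Tail, Avoids123, LateOnce, List.pairwise_cons, List.forall_mem_cons]
  constructor
  · rintro ⟨⟨-, h1⟩, ⟨h2, h3⟩, h6, h4, h5⟩
    exact ⟨h1, h3, h6.2, h5⟩
  · rintro ⟨h1, h2, h6, h3⟩
    refine ⟨⟨by omega, h1⟩, ⟨List.pairwise_of_forall_mem_list ?_, h2⟩, ⟨by omega, h6⟩,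
      fun x hx h => absurd h (lt_irrefl _), h3⟩
    intro x hx y hy h
    have := h1 x hx
    have := h1 y hy
    omega

/-- With no letter below `k` read yet, a later `k` may still precede `k + 1`; it only loses the
right to repeat, so it joins the first alphabet. -/
theorem tail_cons_succ {k : ℕ} {L : List ℕ} :
    Tail k ((k + 1) :: L) ↔ Residual (Finset.Icc 1 k) ∅ {k + 1} L := by
  simp only [Tail, Residual, LateOnce, List.pairwise_cons, List.forall_mem_cons,
    Finset.mem_Icc, Finset.notMem_empty, Finset.mem_singleton, false_or, false_imp_iff, and_true]
  constructor
  · rintro ⟨⟨-, h1⟩, h2, h6, h4, h5⟩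
    refine ⟨fun x hx => ?_, h2.2, ((h6.1 trivial).and h5).imp_of_mem ?_⟩
    · have := h1 x hx
      omega
    · intro x y hx hy h
      have := h1 x hx
      grind
  · rintro ⟨h1, h2, h3⟩
    have hle : ∀ x ∈ L, x ≤ k + 1 := fun x hx => by
      have := h1 x hx
      omega
    rw [avoids123_cons_max hle]
    have hp : L.Pairwise fun x y => x = k → y ≠ k := h3.imp_of_mem fun {x y} hx hy h => by
      have := h1 x hx
      grind
    refine ⟨⟨by omega, fun x hx => ?_⟩, h2, ⟨fun _ => hp, lateOnce_of_pairwise hp⟩,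
      fun x hx => by omega, h3.imp_of_mem fun {x y} hx hy h => ?_⟩
    · have := h1 x hx
      omega
    · have := h1 x hx
      grind

/-! ### Counting the residual languages -/

/-- The number of words of length `l` in `Residual A B ∅`, where `p = #A` and `q = #B`. -/
def bareCount : ℕ → ℕ → ℕ → ℕ
  | 0, _, _ => 1
  | l + 1, p, q => ∑ i ∈ Finset.range p, bareCount l i (q + (p - 1 - i)) +
      ∑ j ∈ Finset.range q, bareCount l p j

/-- The number of words of length `l` in `Residual A B {M}`, where `p = #A` and `q = #B`. -/
def toppedCount : ℕ → ℕ → ℕ → ℕ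
  | 0, _, _ => 1
  | l + 1, p, q => ∑ i ∈ Finset.range p, toppedCount l i (q + (p - 1 - i)) +
      ∑ j ∈ Finset.range q, bareCount l p j + toppedCount l p q

/-- The number of words of length `l` in `ResidualTwo k A B`, where `p = #A` and `q = #B`. -/
def twoCount : ℕ → ℕ → ℕ → ℕ
  | 0, _, _ => 1
  | l + 1, p, q => ∑ i ∈ Finset.range p, twoCount l i (q + (p - 1 - i)) +
      ∑ j ∈ Finset.range q, bareCount l p j + toppedCount l p q + toppedCount l p (q + 1)

/-- The number of words of length `l` in `Tail (k + 1)`. -/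
def tailCount : ℕ → ℕ → ℕ
  | 0, _ => 1
  | l + 1, k => ∑ i ∈ Finset.range k, twoCount l i (k - 1 - i) + tailCount l k +
      toppedCount l (k + 1) 0

theorem card_union_filter_gt {A B : Finset ℕ} (hAB : ∀ x ∈ A, ∀ y ∈ B, x < y) (a : ℕ) :
    (B ∪ A.filter (a < ·)).card = B.card + (A.filter (a < ·)).card := by
  refine Finset.card_union_of_disjoint (Finset.disjoint_left.2 fun x hx hx' => ?_)
  exact lt_irrefl _ (hAB x (Finset.mem_filter.1 hx').1 x hx)

theorem residual_nil (A B T : Finset ℕ) : Residual A B T [] := by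
  simp [Residual, Avoids123]

theorem lt_of_mem_split {A B : Finset ℕ} (hAB : ∀ x ∈ A, ∀ y ∈ B, x < y) (a : ℕ) :
    ∀ x ∈ A.filter (· < a), ∀ y ∈ B ∪ A.filter (a < ·), x < y := by
  intro x hx y hy
  simp only [Finset.mem_filter, Finset.mem_union] at hx hy
  rcases hy with hy | hy
  · exact hAB x hx.1 y hy
  · omega

theorem counts_residual_empty (l : ℕ) : ∀ {A B : Finset ℕ}, (∀ x ∈ A, ∀ y ∈ B, x < y) →
    Counts (Residual A B ∅) l (bareCount l A.card B.card) := by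
  induction l with
  | zero => exact fun _ => Counts.zero (residual_nil _ _ _)
  | succ l ih =>
    intro A B hAB
    have hdisj : Disjoint A B :=
      Finset.disjoint_left.2 fun x hx hx' => lt_irrefl _ (hAB x hx x hx')
    have key := Counts.succ (W := Residual A B ∅) (n := l) (s := A ∪ B)
      (c := fun a => if a ∈ A then bareCount l (A.filter (· < a)).card
          (B.card + (A.filter (a < ·)).card) else bareCount l A.card (B.filter (· < a)).card)
      (fun a L h => by simpa using h.1 a (by simp)) fun a ha => ?_
    · rw [Finset.sum_union hdisj, Finset.sum_congr rfl fun a ha => if_pos ha,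
        Finset.sum_congr (s₁ := B) rfl fun a ha => if_neg (Finset.disjoint_right.1 hdisj ha),
        sum_card_filter_lt_gt A fun i j => bareCount l i (B.card + j),
        sum_card_filter_lt B fun j => bareCount l A.card j] at key
      exact key
    · rcases Finset.mem_union.1 ha with haA | haB
      · rw [if_pos haA, ← card_union_filter_gt hAB]
        exact (ih (lt_of_mem_split hAB a)).congr fun L =>
          residual_cons_low hAB (by simp) (by simp) haA
      · rw [if_neg (Finset.disjoint_right.1 hdisj haB)]
        exact (ih fun x hx y hy => hAB x hx y (Finset.mem_filter.1 hy).1).congr fun L =>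
          residual_cons_mid hAB (by simp) haB

theorem counts_residual_singleton (l : ℕ) : ∀ {A B : Finset ℕ} {M : ℕ},
    (∀ x ∈ A, ∀ y ∈ B, x < y) → (∀ x ∈ A, x < M) → (∀ x ∈ B, x < M) →
    Counts (Residual A B {M}) l (toppedCount l A.card B.card) := by
  induction l with
  | zero => exact fun _ _ _ => Counts.zero (residual_nil _ _ _)
  | succ l ih =>
    intro A B M hAB hA hB
    have hdisj : Disjoint A B :=
      Finset.disjoint_left.2 fun x hx hx' => lt_irrefl _ (hAB x hx x hx')
    have hMA : M ∉ A := fun h => lt_irrefl _ (hA M h)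
    have hMB : M ∉ B := fun h => lt_irrefl _ (hB M h)
    have hdisj' : Disjoint (A ∪ B) {M} := by simp [hMA, hMB]
    have hT : ∀ x ∈ ({M} : Finset ℕ), ∀ y, y ∈ A ∨ y ∈ B ∨ y ∈ ({M} : Finset ℕ) → y ≤ x := by
      simp only [Finset.mem_singleton, forall_eq]
      rintro y (h | h | rfl)
      exacts [(hA y h).le, (hB y h).le, le_rfl]
    have hT' : ∀ x ∈ ({M} : Finset ℕ), x ∉ A ∧ x ∉ B := by simp [hMA, hMB]
    have key := Counts.succ (W := Residual A B {M}) (n := l) (s := A ∪ B ∪ {M})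
      (c := fun a => if a ∈ A then toppedCount l (A.filter (· < a)).card
          (B.card + (A.filter (a < ·)).card) else if a ∈ B then
            bareCount l A.card (B.filter (· < a)).card else toppedCount l A.card B.card)
      (fun a L h => by simpa [or_assoc, or_comm, or_left_comm] using h.1 a (by simp))
      fun a ha => ?_
    · rw [Finset.sum_union hdisj', Finset.sum_union hdisj,
        Finset.sum_congr rfl fun a ha => if_pos ha,
        Finset.sum_congr (s₁ := B) rfl fun a ha =>
          (if_neg (Finset.disjoint_right.1 hdisj ha)).trans (if_pos ha),
        sum_card_filter_lt_gt A fun i j => toppedCount l i (B.card + j),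
        sum_card_filter_lt B fun j => bareCount l A.card j,
        Finset.sum_singleton, if_neg hMA, if_neg hMB] at key
      exact key
    · rcases Finset.mem_union.1 ha with ha | haM
      · rcases Finset.mem_union.1 ha with haA | haB
        · rw [if_pos haA, ← card_union_filter_gt hAB]
          refine (ih (lt_of_mem_split hAB a) ?_ ?_).congr fun L =>
            residual_cons_low hAB hT hT' haA
          · exact fun x hx => hA x (Finset.mem_filter.1 hx).1
          · intro x hx
            rcases Finset.mem_union.1 hx with hx | hx
            exacts [hB x hx, hA x (Finset.mem_filter.1 hx).1]
        · rw [if_neg (Finset.disjoint_right.1 hdisj haB), if_pos haB]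
          exact (counts_residual_empty l fun x hx y hy =>
            hAB x hx y (Finset.mem_filter.1 hy).1).congr fun L =>
              residual_cons_mid hAB (by simpa using hB) haB
      · rw [if_neg (hT' a haM).1, if_neg (hT' a haM).2]
        exact (ih hAB hA hB).congr fun L => residual_cons_top hT hT' haM

theorem counts_residualTwo (l : ℕ) : ∀ {A B : Finset ℕ} {k : ℕ},
    (∀ x ∈ A, ∀ y ∈ B, x < y) → (∀ x ∈ A, x < k) → (∀ x ∈ B, x < k) →
    Counts (ResidualTwo k A B) l (twoCount l A.card B.card) := by
  induction l with
  | zero => exact fun _ _ _ => Counts.zero (by simp [ResidualTwo, Avoids123, LateOnce])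
  | succ l ih =>
    intro A B k hAB hA hB
    have hdisj : Disjoint A B :=
      Finset.disjoint_left.2 fun x hx hx' => lt_irrefl _ (hAB x hx x hx')
    have hkA : k ∉ A := fun h => lt_irrefl _ (hA k h)
    have hkB : k ∉ B := fun h => lt_irrefl _ (hB k h)
    have hkA' : k + 1 ∉ A := fun h => absurd (hA _ h) (by omega)
    have hkB' : k + 1 ∉ B := fun h => absurd (hB _ h) (by omega)
    have hdisj' : Disjoint (A ∪ B) {k, k + 1} := by simp [hkA, hkB, hkA', hkB']
    have key := Counts.succ (W := ResidualTwo k A B) (n := l) (s := A ∪ B ∪ {k, k + 1})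
      (c := fun a => if a ∈ A then twoCount l (A.filter (· < a)).card
          (B.card + (A.filter (a < ·)).card) else if a ∈ B then
            bareCount l A.card (B.filter (· < a)).card else if a = k then
              toppedCount l A.card B.card else toppedCount l A.card (B.card + 1))
      (fun a L h => by simpa [or_assoc, or_comm, or_left_comm] using h.1 a (by simp))
      fun a ha => ?_
    · rw [Finset.sum_union hdisj', Finset.sum_union hdisj,
        Finset.sum_congr rfl fun a ha => if_pos ha,
        Finset.sum_congr (s₁ := B) rfl fun a ha =>
          (if_neg (Finset.disjoint_right.1 hdisj ha)).trans (if_pos ha),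
        sum_card_filter_lt_gt A fun i j => twoCount l i (B.card + j),
        sum_card_filter_lt B fun j => bareCount l A.card j,
        Finset.sum_pair (by omega), if_neg hkA, if_neg hkB, if_pos rfl, if_neg hkA', if_neg hkB',
        if_neg (by omega), ← add_assoc] at key
      exact key
    · rcases Finset.mem_union.1 ha with ha | hak
      · rcases Finset.mem_union.1 ha with haA | haB
        · rw [if_pos haA, ← card_union_filter_gt hAB]
          refine (ih (lt_of_mem_split hAB a) ?_ ?_).congr fun L =>
            residualTwo_cons_low hAB hA hB haA
          · exact fun x hx => hA x (Finset.mem_filter.1 hx).1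
          · intro x hx
            rcases Finset.mem_union.1 hx with hx | hx
            exacts [hB x hx, hA x (Finset.mem_filter.1 hx).1]
        · rw [if_neg (Finset.disjoint_right.1 hdisj haB), if_pos haB]
          exact (counts_residual_empty l fun x hx y hy =>
            hAB x hx y (Finset.mem_filter.1 hy).1).congr fun L =>
              residualTwo_cons_mid hAB hB haB
      · rw [Finset.mem_insert, Finset.mem_singleton] at hak
        rcases hak with rfl | rfl
        · rw [if_neg hkA, if_neg hkB, if_pos rfl]
          exact (counts_residual_singleton l hAB hA hB).congr fun L =>
            residualTwo_cons_self hA hB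
        · rw [if_neg hkA', if_neg hkB', if_neg (by omega), ← Finset.card_insert_of_notMem hkB]
          refine (counts_residual_singleton l ?_ ?_ ?_).congr fun L =>
            residualTwo_cons_succ hA hB
          · intro x hx y hy
            rcases Finset.mem_insert.1 hy with rfl | hy
            exacts [hA x hx, hAB x hx y hy]
          · exact fun x hx => (hA x hx).trans (Nat.lt_succ_self k)
          · intro y hy
            rcases Finset.mem_insert.1 hy with rfl | hy
            exacts [Nat.lt_succ_self y, (hB y hy).trans (Nat.lt_succ_self k)]

theorem counts_tail_cons_low (l : ℕ) {k a : ℕ} (ha : 1 ≤ a) (hak : a < k) :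
    Counts (fun L => Tail k (a :: L)) l (twoCount l (a - 1) (k - 1 - a)) := by
  have := counts_residualTwo l (A := Finset.Ico 1 a) (B := Finset.Ioo a k) (k := k)
    (by simp; omega) (by simp; omega) (by simp)
  rw [Nat.card_Ico, Nat.card_Ioo, Nat.sub_right_comm] at this
  exact this.congr fun L => tail_cons_low ha hak

theorem sum_Ico_one_twoCount (l k : ℕ) :
    ∑ a ∈ Finset.Ico 1 (k + 1), twoCount l (a - 1) (k + 1 - 1 - a) =
      ∑ i ∈ Finset.range k, twoCount l i (k - 1 - i) := by
  rw [Finset.sum_Ico_eq_sum_range]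
  refine Finset.sum_congr rfl fun i _ => ?_
  congr 1 <;> omega

theorem counts_tail (l k : ℕ) : Counts (Tail (k + 1)) l (tailCount l k) := by
  induction l with
  | zero => exact Counts.zero (by simp [Tail, Avoids123, LateOnce])
  | succ l ih =>
    have key := Counts.succ (W := Tail (k + 1)) (n := l) (s := Finset.Icc 1 (k + 1 + 1))
      (c := fun a => if a < k + 1 then twoCount l (a - 1) (k + 1 - 1 - a) else
        if a = k + 1 then tailCount l k else toppedCount l (k + 1) 0)
      (fun a L h => by simpa using h.1 a (by simp)) fun a ha => ?_
    · rw [← Finset.Ico_add_one_right_eq_Icc, Finset.sum_Ico_succ_top (by omega),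
        Finset.sum_Ico_succ_top (by omega),
        Finset.sum_congr rfl fun a ha => if_pos (Finset.mem_Ico.1 ha).2,
        sum_Ico_one_twoCount, if_neg (by omega), if_pos rfl, if_neg (by omega),
        if_neg (by omega)] at key
      exact key
    · rw [Finset.mem_Icc] at ha
      split_ifs with h h'
      · exact counts_tail_cons_low l ha.1 h
      · subst h'
        exact ih.congr fun L => tail_cons_self (by omega)
      · obtain rfl : a = k + 1 + 1 := by omega
        have := counts_residual_singleton l (A := Finset.Icc 1 (k + 1)) (B := ∅) (M := k + 1 + 1)
          (by simp) (by simp) (by simp)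
        rw [Nat.card_Icc, Finset.card_empty] at this
        exact this.congr fun L => tail_cons_succ

/-! ### Pattern-avoiding restricted growth words -/

/-- `L` continues a restricted growth word with maximum `m` to a restricted growth word. -/
def GrowsFrom : ℕ → List ℕ → Prop
  | _, [] => True
  | m, a :: L => (1 ≤ a ∧ a ≤ m + 1) ∧ GrowsFrom (max m a) L

/-- No subsequence of the word is order-isomorphic to `1211` or to `1123`. -/
def AvoidsBoth (L : List ℕ) : Prop :=
  (∀ a b, a < b → ¬ [a, b, a, a].Sublist L) ∧
    ∀ a b c, a < b → b < c → ¬ [a, a, b, c].Sublist L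

/-- `L` continues `12⋯k` to a restricted growth word that avoids both patterns. -/
def Continuation (k : ℕ) (L : List ℕ) : Prop :=
  GrowsFrom k L ∧ AvoidsBoth (List.range' 1 k ++ L)

theorem avoids123_iff {L : List ℕ} :
    Avoids123 L ↔ ∀ a b c, a < b → b < c → ¬ [a, b, c].Sublist L := by
  induction L with
  | nil => simp [Avoids123]
  | cons d L ih =>
    simp only [Avoids123, ih, List.pairwise_iff_forall_sublist, List.cons_sublist_cons']
    constructor
    · rintro ⟨h1, h2⟩ a b c hab hbc (h | ⟨rfl, h⟩)
      · exact h2 a b c hab hbc h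
      · exact absurd (h1 h hab) hbc.not_ge
    · intro h
      refine ⟨fun {x y} hxy hd => ?_, fun a b c hab hbc h' => h a b c hab hbc (Or.inl h')⟩
      by_contra! hlt
      exact h d x y hd hlt (Or.inr ⟨rfl, hxy⟩)

theorem lateOnce_iff {k : ℕ} {L : List ℕ} :
    LateOnce k L ↔ ¬ [k + 1, k, k].Sublist L := by
  induction L with
  | nil => simp [LateOnce]
  | cons d L ih =>
    simp only [LateOnce, ih, List.pairwise_iff_forall_sublist, List.cons_sublist_cons']
    grind

/-- A growth word cannot pass `m + 1` without first using it. -/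
theorem GrowsFrom.pair_sublist {m x : ℕ} {L : List ℕ} (h : GrowsFrom m L) (hx : x ∈ L)
    (hmx : m + 1 < x) : [m + 1, x].Sublist L := by
  induction L generalizing m with
  | nil => simp at hx
  | cons a L ih =>
    obtain ⟨⟨h1, h2⟩, h3⟩ := h
    have hxL : x ∈ L := by
      rcases List.mem_cons.1 hx with rfl | hx
      · omega
      · exact hx
    rcases h2.eq_or_lt with rfl | h2
    · exact List.cons_sublist_cons.2 (List.singleton_sublist.2 hxL)
    · rw [max_eq_left (by omega)] at h3
      exact (ih h3 hxL hmx).cons a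

theorem growsFrom_of_le {m : ℕ} {L : List ℕ} (h : ∀ x ∈ L, 1 ≤ x ∧ x ≤ m + 1) :
    GrowsFrom m L := by
  induction L generalizing m with
  | nil => trivial
  | cons a L ih =>
    rw [List.forall_mem_cons] at h
    exact ⟨h.1, ih fun x hx => ⟨(h.2 x hx).1, (h.2 x hx).2.trans (by omega)⟩⟩

theorem GrowsFrom.one_le {m x : ℕ} {L : List ℕ} (h : GrowsFrom m L) (hx : x ∈ L) : 1 ≤ x := by
  induction L generalizing m with
  | nil => simp at hx
  | cons a L ih =>
    rcases List.mem_cons.1 hx with rfl | hx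
    exacts [h.1.1, ih h.2 hx]

theorem Continuation.tail {k a : ℕ} {L : List ℕ} (hak : a ≤ k) (h : Continuation k (a :: L)) :
    Tail k (a :: L) := by
  obtain ⟨hg, h1, h2⟩ := h
  have ha : 1 ≤ a := hg.1.1
  have hmem : ∀ x, 1 ≤ x → x ≤ k → x ∈ List.range' 1 k := by
    simp only [List.mem_range'_1]
    omega
  have hle : ∀ x ∈ a :: L, x ≤ k + 1 := by
    intro x hx
    by_contra! hlt
    refine h2 a (k + 1) x (by omega) hlt ?_
    have hp := hg.2
    rw [max_eq_left hak] at hp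
    have hxL : x ∈ L := by
      rcases List.mem_cons.1 hx with rfl | hx
      · omega
      · exact hx
    exact List.Sublist.append (List.singleton_sublist.2 (hmem a ha hak))
      (List.cons_sublist_cons.2 (hp.pair_sublist hxL hlt))
  refine ⟨fun x hx => ⟨hg.one_le hx, hle x hx⟩, avoids123_iff.2 fun x y z hxy hyz hs => ?_,
    lateOnce_iff.2 fun hs => ?_, List.pairwise_iff_forall_sublist.2 fun {x y} hs hx hxy => ?_⟩
  · have hx := hg.one_le (hs.subset (by simp : x ∈ [x, y, z]))
    have hz := hle z (hs.subset (by simp : z ∈ [x, y, z]))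
    exact h2 x y z hxy hyz
      (List.Sublist.append (List.singleton_sublist.2 (hmem x hx (by omega))) hs)
  · exact h1 k (k + 1) (by omega)
      (List.Sublist.append (List.singleton_sublist.2 (hmem k (by omega) le_rfl)) hs)
  · subst hxy
    have hy := hg.one_le (hs.subset (by simp : y ∈ [y, y]))
    -- As `y < k`, the prefix supplies `y, y + 1`, and the two later copies of `y` complete 1211.
    refine h1 y (y + 1) (by omega) (List.Sublist.append (l₁ := [y, y + 1]) ?_ hs)
    rw [show k = (y - 1) + (k - (y - 1)) by omega, ← List.range'_append_1,
      show k - (y - 1) = (k - (y + 1)) + 1 + 1 by omega, List.range'_succ, List.range'_succ,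
      show 1 + (y - 1) = y by omega]
    exact List.sublist_append_of_sublist_right (by simp)

theorem Tail.continuation {k : ℕ} {L : List ℕ} (h : Tail k L) : Continuation k L := by
  obtain ⟨h1, h2, h3, h4⟩ := h
  rw [avoids123_iff] at h2
  rw [lateOnce_iff] at h3
  rw [List.pairwise_iff_forall_sublist] at h4
  have hinc : ∀ x y, [x, y].Sublist (List.range' 1 k) → x < y ∧ y ≤ k := by
    intro x y hs
    have := List.pairwise_iff_forall_sublist.1 (List.pairwise_lt_range' (s := 1) (n := k)) hs
    have hy := hs.subset (by simp : y ∈ [x, y])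
    rw [List.mem_range'_1] at hy
    omega
  have hle : ∀ x l, (x :: l).Sublist (List.range' 1 k) → x ≤ k := by
    intro x l hs
    have hx := hs.subset (by simp : x ∈ x :: l)
    rw [List.mem_range'_1] at hx
    omega
  refine ⟨growsFrom_of_le h1, fun a b hab hs => ?_, fun a b c hab hbc hs => ?_⟩
  · obtain ⟨l₁, l₂, e, hl₁, hl₂⟩ := List.sublist_append_iff.1 hs
    have hbaa : a ≤ k → ¬ [b, a, a].Sublist L := by
      intro hak hs'
      have hb := (h1 b (hs'.subset (by simp))).2
      rcases hak.eq_or_lt with rfl | hak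
      · obtain rfl : b = a + 1 := by omega
        exact h3 hs'
      · exact h4 ((List.sublist_cons_self b _).trans hs') hak rfl
    rcases l₁ with _ | ⟨x, _ | ⟨y, l⟩⟩
    · obtain rfl : [a, b, a, a] = l₂ := e
      have hb := (h1 b (hl₂.subset (by simp))).2
      exact hbaa (by omega) ((List.sublist_cons_self a _).trans hl₂)
    · obtain ⟨rfl, rfl⟩ : a = x ∧ [b, a, a] = l₂ := by simpa using e
      exact hbaa (hle _ _ hl₁) hl₂
    · have hxy := hinc x y (List.Sublist.trans (by simp) hl₁)
      obtain ⟨rfl, rfl, e'⟩ : a = x ∧ b = y ∧ [a, a] = l ++ l₂ := by simpa using e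
      rcases l with _ | ⟨z, l⟩
      · obtain rfl : [a, a] = l₂ := e'
        exact h4 hl₂ (by omega) rfl
      · have hz : a = z := (List.cons.inj e').1
        have := hinc b z (List.Sublist.trans (by simp) hl₁)
        omega
  · obtain ⟨l₁, l₂, e, hl₁, hl₂⟩ := List.sublist_append_iff.1 hs
    rcases l₁ with _ | ⟨x, _ | ⟨y, l⟩⟩
    · obtain rfl : [a, a, b, c] = l₂ := e
      exact h2 a b c hab hbc ((List.sublist_cons_self a _).trans hl₂)
    · obtain ⟨rfl, rfl⟩ : a = x ∧ [a, b, c] = l₂ := by simpa using e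
      exact h2 a b c hab hbc hl₂
    · have hxy := hinc x y (List.Sublist.trans (by simp) hl₁)
      obtain ⟨rfl, rfl, -⟩ : a = x ∧ a = y ∧ [b, c] = l ++ l₂ := by simpa using e
      omega

theorem continuation_cons_iff_tail {k a : ℕ} {L : List ℕ} (hak : a ≤ k) :
    Continuation k (a :: L) ↔ Tail k (a :: L) :=
  ⟨Continuation.tail hak, Tail.continuation⟩

theorem continuation_cons_succ {k : ℕ} {L : List ℕ} :
    Continuation k ((k + 1) :: L) ↔ Continuation (k + 1) L := by
  have e : List.range' 1 k ++ (k + 1) :: L = List.range' 1 (k + 1) ++ L := by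
    rw [List.range'_1_concat, List.append_assoc, add_comm 1 k]
    rfl
  rw [Continuation, Continuation, e, GrowsFrom, max_eq_right (by omega)]
  exact and_congr_left fun _ => and_iff_right ⟨by omega, le_rfl⟩

/-- The number of words of length `l` that continue `12⋯k` and do not begin with `k + 1`. -/
def repeatCount : ℕ → ℕ → ℕ
  | 0, _ => 1
  | _ + 1, 0 => 0
  | l + 1, k + 1 => ∑ i ∈ Finset.range k, twoCount l i (k - 1 - i) + tailCount l k

/-- Here `x.1` is the number of further new letters before the first repeat, and `x.2` the length of
what remains. At `k = 0` the sum is a coefficient of `paramGF repeatCount`. -/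
theorem counts_continuation (l k : ℕ) :
    Counts (Continuation k) l (∑ x ∈ Finset.HasAntidiagonal.antidiagonal l, repeatCount x.2 (k + x.1)) := by
  induction l generalizing k with
  | zero =>
    refine Counts.zero ⟨trivial, ?_, ?_⟩
    · intro a b hab hs
      rw [List.append_nil] at hs
      have := List.pairwise_iff_forall_sublist.1 (List.pairwise_lt_range' (s := 1) (n := k))
        (List.Sublist.trans (by simp : [a, a].Sublist [a, b, a, a]) hs)
      omega
    · intro a b c hab hbc hs
      rw [List.append_nil] at hs
      have := List.pairwise_iff_forall_sublist.1 (List.pairwise_lt_range' (s := 1) (n := k))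
        (List.Sublist.trans (by simp : [a, a].Sublist [a, a, b, c]) hs)
      omega
  | succ l ih =>
    rw [Finset.Nat.sum_antidiagonal_succ]
    have key := Counts.succ (W := Continuation k) (n := l) (s := Finset.Icc 1 (k + 1))
      (c := fun a => if a < k then twoCount l (a - 1) (k - 1 - a) else
        if a = k then tailCount l (k - 1) else
          ∑ x ∈ Finset.HasAntidiagonal.antidiagonal l, repeatCount x.2 (k + 1 + x.1))
      (fun a L h => by simpa using h.1.1) fun a ha => ?_
    · rw [← Finset.Ico_add_one_right_eq_Icc, Finset.sum_Ico_succ_top (by omega),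
        if_neg (by omega), if_neg (by omega)] at key
      simp only [add_assoc, add_comm 1] at key ⊢
      convert key using 2
      rcases k with _ | k
      · simp [repeatCount]
      · rw [Finset.sum_Ico_succ_top (by omega),
          Finset.sum_congr rfl fun a ha => if_pos (Finset.mem_Ico.1 ha).2,
          sum_Ico_one_twoCount, if_neg (by omega), if_pos rfl]
        rfl
    · rw [Finset.mem_Icc] at ha
      split_ifs with h h'
      · exact (counts_tail_cons_low l ha.1 h).congr fun L => continuation_cons_iff_tail h.le
      · subst h'
        obtain ⟨k, rfl⟩ := Nat.exists_eq_add_of_le' ha.1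
        exact (counts_tail l k).congr fun L =>
          (continuation_cons_iff_tail le_rfl).trans (tail_cons_self ha.1)
      · obtain rfl : a = k + 1 := by omega
        exact (ih (k + 1)).congr fun L => continuation_cons_succ

/-! ### Set partitions and restricted growth words -/

/-- The word `w` is a restricted growth function. -/
def IsGrowth {n : ℕ} (w : Fin n → ℕ) : Prop :=
  ∀ j, 1 ≤ w j ∧ ∀ a, 1 ≤ a → a < w j → ∃ i < j, w i = a

theorem growsFrom_ofFn {n : ℕ} (m : ℕ) (w : Fin n → ℕ) :
    GrowsFrom m (List.ofFn w) ↔ ∀ j, 1 ≤ w j ∧ ∀ a, m < a → a < w j → ∃ i < j, w i = a := by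
  induction n generalizing m with
  | zero => simp [GrowsFrom]
  | succ n ih =>
    simp only [List.ofFn_succ, GrowsFrom, ih, Fin.forall_fin_succ, Fin.exists_fin_succ,
      Fin.succ_lt_succ_iff, Fin.succ_pos, true_and, not_lt_zero, false_and, or_false,
      exists_false, imp_false, not_lt]
    constructor
    · rintro ⟨⟨h1, h2⟩, h3⟩
      refine ⟨⟨h1, fun a ha => by omega⟩, fun j => ⟨(h3 j).1, fun a ha haj => ?_⟩⟩
      by_cases h : w 0 = a
      · exact Or.inl h
      · exact Or.inr ((h3 j).2 a (by omega) haj)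
    · rintro ⟨⟨h1, h2⟩, h3⟩
      refine ⟨⟨h1, ?_⟩, fun j => ⟨(h3 j).1, fun a ha haj => ?_⟩⟩
      · by_contra! h
        exact absurd (h2 (m + 1) (by omega)) (by omega)
      · exact ((h3 j).2 a (by omega) haj).resolve_left (by omega)

/-- At the first disagreement the larger letter forces the smaller one to have occurred earlier in
its word; by agreement up to there, the kernels would differ. -/
theorem IsGrowth.eq {n : ℕ} {w w' : Fin n → ℕ} (hw : IsGrowth w) (hw' : IsGrowth w')
    (h : ∀ i j, w i = w j ↔ w' i = w' j) : w = w' := by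
  funext j
  induction j using WellFoundedLT.induction with
  | _ j ih =>
    rcases lt_trichotomy (w j) (w' j) with hlt | heq | hlt
    · obtain ⟨i, hij, hi⟩ := (hw' j).2 _ (hw j).1 hlt
      exact absurd (((h i j).1 ((ih i hij).trans hi)).symm.trans hi) hlt.ne'
    · exact heq
    · obtain ⟨i, hij, hi⟩ := (hw j).2 _ (hw' j).1 hlt
      exact absurd (((h i j).2 ((ih i hij).symm.trans hi)).symm.trans hi) hlt.ne'

/-- Ranks are strictly monotone in `f`, hence an injection of `s` into `[1, s.card]`, which is onto
by cardinality. -/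
theorem surj_rank {ι α : Type*} [LinearOrder α] (s : Finset ι) (f : ι → α) (hf : Set.InjOn f s)
    {a : ℕ} (ha : 1 ≤ a) (has : a ≤ s.card) :
    ∃ x ∈ s, (s.filter fun y => f y ≤ f x).card = a := by
  have hlt : ∀ x ∈ s, ∀ y ∈ s, f x < f y →
      (s.filter fun z => f z ≤ f x).card < (s.filter fun z => f z ≤ f y).card := by
    intro x hx y hy hxy
    refine Finset.card_lt_card ⟨fun z hz => ?_, fun hsub => ?_⟩
    · rw [Finset.mem_filter] at hz ⊢
      exact ⟨hz.1, hz.2.trans hxy.le⟩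
    · have := hsub (Finset.mem_filter.2 ⟨hy, le_rfl⟩)
      exact absurd (Finset.mem_filter.1 this).2 hxy.not_ge
  have himg : s.image (fun x => (s.filter fun y => f y ≤ f x).card) = Finset.Icc 1 s.card := by
    refine Finset.eq_of_subset_of_card_le (fun b hb => ?_) ?_
    · obtain ⟨x, hx, rfl⟩ := Finset.mem_image.1 hb
      exact Finset.mem_Icc.2 ⟨Finset.card_pos.2 ⟨x, Finset.mem_filter.2 ⟨hx, le_rfl⟩⟩,
        Finset.card_filter_le _ _⟩
    · rw [Nat.card_Icc, Nat.add_sub_cancel, Finset.card_image_of_injOn]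
      intro x hx y hy hxy
      rcases lt_trichotomy (f x) (f y) with h | h | h
      · exact absurd hxy (hlt x hx y hy h).ne
      · exact hf hx hy h
      · exact absurd hxy (hlt y hy x hx h).ne'
  have := himg.symm ▸ Finset.mem_Icc.2 ⟨ha, has⟩
  exact Finset.mem_image.1 this

section

variable {n : ℕ} (P : Finpartition (Finset.univ : Finset (Fin n)))

theorem min_injOn_parts : Set.InjOn Finset.min (P.parts : Set (Finset (Fin n))) := by
  intro B hB C hC h
  obtain ⟨x, hx⟩ := Finset.min_of_nonempty (P.nonempty_of_mem_parts hB)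
  exact P.eq_of_mem_parts hB hC (Finset.mem_of_min hx) (Finset.mem_of_min (h ▸ hx))

theorem canonicalWord_le_of_min_le {i j : Fin n} (h : (P.part i).min ≤ (P.part j).min) :
    canonicalWord P i ≤ canonicalWord P j := by
  refine Finset.card_le_card fun B hB => ?_
  rw [Finset.mem_filter] at hB ⊢
  exact ⟨hB.1, hB.2.trans h⟩

theorem canonicalWord_lt_of_min_lt {i j : Fin n} (h : (P.part i).min < (P.part j).min) :
    canonicalWord P i < canonicalWord P j := by
  refine Finset.card_lt_card ⟨fun B hB => ?_, fun hsub => ?_⟩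
  · rw [Finset.mem_filter] at hB ⊢
    exact ⟨hB.1, hB.2.trans h.le⟩
  · have := hsub (Finset.mem_filter.2 ⟨P.part_mem.2 (Finset.mem_univ j), le_rfl⟩)
    exact absurd (Finset.mem_filter.1 this).2 h.not_ge

theorem canonicalWord_eq_iff {i j : Fin n} :
    canonicalWord P i = canonicalWord P j ↔ P.part i = P.part j := by
  refine ⟨fun h => ?_, fun h => by rw [canonicalWord, canonicalWord, h]⟩
  rcases lt_trichotomy (P.part i).min (P.part j).min with hlt | heq | hlt
  · exact absurd h (canonicalWord_lt_of_min_lt P hlt).ne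
  · exact min_injOn_parts P (P.part_mem.2 (Finset.mem_univ i))
      (P.part_mem.2 (Finset.mem_univ j)) heq
  · exact absurd h (canonicalWord_lt_of_min_lt P hlt).ne'

theorem isGrowth_canonicalWord : IsGrowth (canonicalWord P) := by
  intro j
  have hj : P.part j ∈ P.parts := P.part_mem.2 (Finset.mem_univ j)
  refine ⟨Finset.card_pos.2 ⟨_, Finset.mem_filter.2 ⟨hj, le_rfl⟩⟩, fun a ha haj => ?_⟩
  obtain ⟨B, hB, rfl⟩ := surj_rank P.parts Finset.min (min_injOn_parts P) ha
    (haj.le.trans (Finset.card_filter_le _ _))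
  obtain ⟨i, hi⟩ := Finset.min_of_nonempty (P.nonempty_of_mem_parts hB)
  have hBi : P.part i = B := P.part_eq_of_mem hB (Finset.mem_of_min hi)
  have hci : canonicalWord P i = (P.parts.filter fun C => C.min ≤ B.min).card := by
    rw [canonicalWord, hBi]
  refine ⟨i, ?_, hci⟩
  by_contra! hji
  refine haj.not_ge (hci ▸ canonicalWord_le_of_min_le P ?_)
  rw [hBi, hi]
  exact (Finset.min_le (P.mem_part (Finset.mem_univ j))).trans (WithTop.coe_le_coe.2 hji)

end

theorem canonicalWord_injective {n : ℕ} :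
    Function.Injective (canonicalWord (n := n)) := by
  intro P Q h
  have hpart : ∀ i, P.part i = Q.part i := by
    intro i
    ext j
    rw [← P.part_eq_iff_mem (P.part_mem.2 (Finset.mem_univ i)),
      ← Q.part_eq_iff_mem (Q.part_mem.2 (Finset.mem_univ i)),
      ← canonicalWord_eq_iff, ← canonicalWord_eq_iff, h]
  have hsub : ∀ P Q : Finpartition (Finset.univ : Finset (Fin n)),
      (∀ i, P.part i = Q.part i) → P.parts ⊆ Q.parts := by
    intro P Q hpart B hB
    obtain ⟨i, hi⟩ := P.nonempty_of_mem_parts hB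
    rw [← P.part_eq_of_mem hB hi, hpart]
    exact Q.part_mem.2 (Finset.mem_univ i)
  exact Finpartition.ext ((hsub P Q hpart).antisymm (hsub Q P fun i => (hpart i).symm))

theorem exists_canonicalWord_eq {n : ℕ} {w : Fin n → ℕ} (hw : IsGrowth w) :
    ∃ P, canonicalWord P = w := by
  classical
  -- Take the partition into the fibres of `w`; its canonical word has the same kernel as `w`.
  refine ⟨Finpartition.ofSetoid (Setoid.ker w), (isGrowth_canonicalWord _).eq hw fun i j => ?_⟩
  rw [canonicalWord_eq_iff, Finpartition.part_eq_iff_mem _ (Finpartition.part_mem _ |>.2 (Finset.mem_univ j)),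
    Finpartition.mem_part_ofSetoid_iff_rel, Setoid.ker_def, eq_comm]

/-! ### Pattern containment as a sublist condition -/

theorem ofFn_sublist_ofFn_iff {m n : ℕ} {v : Fin m → ℕ} {w : Fin n → ℕ} :
    (List.ofFn v).Sublist (List.ofFn w) ↔
      ∃ f : Fin m → Fin n, StrictMono f ∧ ∀ i, w (f i) = v i := by
  rw [List.sublist_iff_exists_fin_orderEmbedding_get_eq]
  constructor
  · rintro ⟨f, hf⟩
    refine ⟨fun i => Fin.cast (by simp) (f (Fin.cast (by simp) i)), fun i j hij => ?_, fun i => ?_⟩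
    · exact f.strictMono (a := Fin.cast _ i) (b := Fin.cast _ j) hij
    · have := hf (Fin.cast (by simp) i)
      rw [List.get_ofFn, List.get_ofFn] at this
      exact this.symm
  · rintro ⟨f, hf, h⟩
    refine ⟨OrderEmbedding.ofStrictMono
      (fun i => Fin.cast (by simp) (f (Fin.cast (by simp) i))) fun i j hij => ?_, fun i => ?_⟩
    · exact hf (a := Fin.cast _ i) (b := Fin.cast _ j) hij
    · rw [List.get_ofFn, List.get_ofFn]
      exact (h _).symm

theorem containsPattern_1123_iff {n : ℕ} {w : Fin n → ℕ} :
    ContainsPattern w [1, 1, 2, 3] ↔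
      ∃ a b c, a < b ∧ b < c ∧ [a, a, b, c].Sublist (List.ofFn w) := by
  constructor
  · rintro ⟨f, hf, h⟩
    have h01 := h (0 : Fin 4) (1 : Fin 4)
    have h12 := (h (1 : Fin 4) (2 : Fin 4)).1.2 (by decide)
    have h23 := (h (2 : Fin 4) (3 : Fin 4)).1.2 (by decide)
    have e : w (f (0 : Fin 4)) = w (f (1 : Fin 4)) :=
      le_antisymm (not_lt.1 fun hlt => absurd (h01.2.1 hlt) (by decide))
        (not_lt.1 fun hlt => absurd (h01.1.1 hlt) (by decide))
    refine ⟨_, _, _, h12, h23, ?_⟩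
    have := (ofFn_sublist_ofFn_iff (v := w ∘ f)).2 ⟨f, hf, fun i => rfl⟩
    simpa [List.ofFn_succ, e] using this
  · rintro ⟨a, b, c, hab, hbc, hs⟩
    obtain ⟨f, hf, h⟩ := ofFn_sublist_ofFn_iff (v := ![a, a, b, c]).1 (by simpa using hs)
    refine ⟨f, hf, ?_⟩
    change ∀ i j : Fin 4, _
    simp only [h]
    simp [Fin.forall_fin_succ]
    omega

theorem containsPattern_1211_iff {n : ℕ} {w : Fin n → ℕ} :
    ContainsPattern w [1, 2, 1, 1] ↔ ∃ a b, a < b ∧ [a, b, a, a].Sublist (List.ofFn w) := by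
  constructor
  · rintro ⟨f, hf, h⟩
    have h02 := h (0 : Fin 4) (2 : Fin 4)
    have h03 := h (0 : Fin 4) (3 : Fin 4)
    have h01 := (h (0 : Fin 4) (1 : Fin 4)).1.2 (by decide)
    have e : w (f (2 : Fin 4)) = w (f (0 : Fin 4)) :=
      le_antisymm (not_lt.1 fun hlt => absurd (h02.1.1 hlt) (by decide))
        (not_lt.1 fun hlt => absurd (h02.2.1 hlt) (by decide))
    have e' : w (f (3 : Fin 4)) = w (f (0 : Fin 4)) :=
      le_antisymm (not_lt.1 fun hlt => absurd (h03.1.1 hlt) (by decide))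
        (not_lt.1 fun hlt => absurd (h03.2.1 hlt) (by decide))
    refine ⟨_, _, h01, ?_⟩
    have := (ofFn_sublist_ofFn_iff (v := w ∘ f)).2 ⟨f, hf, fun i => rfl⟩
    simpa [List.ofFn_succ, e, e'] using this
  · rintro ⟨a, b, hab, hs⟩
    obtain ⟨f, hf, h⟩ := ofFn_sublist_ofFn_iff (v := ![a, b, a, a]).1 (by simpa using hs)
    refine ⟨f, hf, ?_⟩
    change ∀ i j : Fin 4, _
    simp only [h]
    simp [Fin.forall_fin_succ]
    omega

theorem avoidCount_eq {n c : ℕ} (h : Counts (Continuation 0) n c) :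
    avoidCount {[1, 1, 2, 3], [1, 2, 1, 1]} n = c := by
  obtain ⟨s, hs, rfl⟩ := h
  have key : ∀ w : Fin n → ℕ, (∀ τ ∈ ({[1, 1, 2, 3], [1, 2, 1, 1]} : Set (List ℕ)),
      ¬ ContainsPattern w τ) ∧ IsGrowth w ↔ List.ofFn w ∈ s := by
    intro w
    rw [hs, and_iff_right (List.length_ofFn), Continuation, growsFrom_ofFn, AvoidsBoth]
    simp only [Set.mem_insert_iff, Set.mem_singleton_iff, forall_eq_or_imp, forall_eq,
      containsPattern_1123_iff, containsPattern_1211_iff, not_exists, not_and, List.range'_zero,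
      List.nil_append, IsGrowth, Nat.succ_le_iff]
    tauto
  rw [avoidCount, ← Nat.card_eq_finsetCard s]
  refine Nat.card_congr (Equiv.ofBijective
    (fun P => ⟨List.ofFn (canonicalWord P.1), (key _).1 ⟨P.2, isGrowth_canonicalWord _⟩⟩) ⟨?_, ?_⟩)
  · intro P Q h
    exact Subtype.ext (canonicalWord_injective (List.ofFn_injective (Subtype.ext_iff.1 h)))
  · rintro ⟨L, hL⟩
    obtain ⟨w, rfl⟩ : ∃ w : Fin n → ℕ, List.ofFn w = L := by
      obtain rfl := ((hs L).1 hL).1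
      exact ⟨L.get, List.ofFn_get L⟩
    obtain ⟨hw, hg⟩ := (key w).2 hL
    obtain ⟨P, rfl⟩ := exists_canonicalWord_eq hg
    exact ⟨⟨P, hw⟩, rfl⟩

/-! ### Generating functions -/

section GeneratingFunctions

open PowerSeries

/-- The generating function `∑ c l p X ^ (p + l)`. -/
noncomputable def paramGF (c : ℕ → ℕ → ℕ) : ℚ⟦X⟧ :=
  PowerSeries.mk fun n => ∑ x ∈ Finset.HasAntidiagonal.antidiagonal n, (c x.2 x.1 : ℚ)

theorem paramGF_add (c d : ℕ → ℕ → ℕ) :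
    paramGF (fun l p => c l p + d l p) = paramGF c + paramGF d := by
  ext n
  simp [paramGF, Finset.sum_add_distrib]

theorem paramGF_sum {ι : Type*} (s : Finset ι) (c : ι → ℕ → ℕ → ℕ) :
    paramGF (fun l p => ∑ j ∈ s, c j l p) = ∑ j ∈ s, paramGF (c j) := by
  ext n
  simp only [paramGF, coeff_mk, map_sum, Nat.cast_sum]
  exact Finset.sum_comm

theorem paramGF_eq_of_length {c : ℕ → ℕ → ℕ} (h : ∀ p, c 0 p = 1) :
    paramGF c = PowerSeries.mk 1 + X * paramGF fun l p => c (l + 1) p := by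
  ext n
  cases n with
  | zero => simp [paramGF, h]
  | succ n =>
    rw [map_add, coeff_succ_X_mul]
    simp only [paramGF, coeff_mk]
    rw [Finset.Nat.sum_antidiagonal_succ']
    simp [h]

theorem paramGF_eq_of_param (c : ℕ → ℕ → ℕ) :
    paramGF c = PowerSeries.mk (fun l => (c l 0 : ℚ)) + X * paramGF fun l p => c l (p + 1) := by
  ext n
  cases n with
  | zero => simp [paramGF]
  | succ n =>
    rw [map_add, coeff_succ_X_mul]
    simp only [paramGF, coeff_mk]
    rw [Finset.Nat.sum_antidiagonal_succ]

/-- The sum of `c l i (q + j)` over all `i + j = p`. -/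
def diagonalSum (c : ℕ → ℕ → ℕ → ℕ) (q l p : ℕ) : ℕ :=
  ∑ x ∈ Finset.HasAntidiagonal.antidiagonal p, c l x.1 (q + x.2)

theorem paramGF_sum_range (c : ℕ → ℕ → ℕ → ℕ) (q : ℕ) :
    paramGF (fun l p => ∑ i ∈ Finset.range p, c l i (q + (p - 1 - i))) =
      X * paramGF (diagonalSum c q) := by
  rw [paramGF_eq_of_param]
  have h : (PowerSeries.mk fun _ => ((0 : ℕ) : ℚ)) = 0 := by
    ext n
    simp
  simp only [Finset.sum_range_zero, h, zero_add]
  congr 2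
  funext l p
  rw [diagonalSum, Finset.Nat.sum_antidiagonal_eq_sum_range_succ_mk]
  rfl

/-- Split off the terms with `j = 0`; in the others, lowering `j` and `p` by one raises the offset
to `q + 1`. -/
theorem paramGF_diagonalSum (c : ℕ → ℕ → ℕ → ℕ) (q : ℕ) :
    paramGF (diagonalSum c q) =
      paramGF (fun l p => c l p q) + X * paramGF (diagonalSum c (q + 1)) := by
  have h : (fun l p => diagonalSum c q l (p + 1)) =
      fun l p => c l (p + 1) q + diagonalSum c (q + 1) l p := by
    funext l p
    rw [diagonalSum, Finset.Nat.sum_antidiagonal_succ', diagonalSum]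
    simp only [add_zero, add_assoc, add_comm 1]
  rw [paramGF_eq_of_param (diagonalSum c q), paramGF_eq_of_param fun l p => c l p q, h,
    paramGF_add]
  simp only [diagonalSum, Finset.Nat.antidiagonal_zero, Finset.sum_singleton, add_zero]
  ring

theorem paramGF_bareCount (q : ℕ) : paramGF (fun l p => bareCount l p q) =
    PowerSeries.mk 1 + X * (X * paramGF (diagonalSum bareCount q) +
      ∑ j ∈ Finset.range q, paramGF fun l p => bareCount l p j) := by
  rw [paramGF_eq_of_length fun _ => rfl, ← paramGF_sum_range, ← paramGF_sum, ← paramGF_add]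
  rfl

theorem paramGF_toppedCount (q : ℕ) : paramGF (fun l p => toppedCount l p q) =
    PowerSeries.mk 1 + X * (X * paramGF (diagonalSum toppedCount q) +
      ∑ j ∈ Finset.range q, paramGF (fun l p => bareCount l p j) +
        paramGF fun l p => toppedCount l p q) := by
  conv_lhs => rw [paramGF_eq_of_length fun _ => rfl]
  rw [← paramGF_sum_range, ← paramGF_sum, ← paramGF_add, ← paramGF_add]
  rfl

theorem paramGF_twoCount (q : ℕ) : paramGF (fun l p => twoCount l p q) =
    PowerSeries.mk 1 + X * (X * paramGF (diagonalSum twoCount q) +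
      ∑ j ∈ Finset.range q, paramGF (fun l p => bareCount l p j) +
        paramGF (fun l p => toppedCount l p q) +
          paramGF fun l p => toppedCount l p (q + 1)) := by
  rw [paramGF_eq_of_length fun _ => rfl, ← paramGF_sum_range, ← paramGF_sum, ← paramGF_add,
    ← paramGF_add, ← paramGF_add]
  rfl

theorem sum_range_twoCount (l k : ℕ) : ∑ i ∈ Finset.range k, twoCount l i (k - 1 - i) =
    ∑ i ∈ Finset.range k, twoCount l i (0 + (k - 1 - i)) := by
  simp only [zero_add]

theorem toppedCount_zero_zero (l : ℕ) : toppedCount l 0 0 = 1 := by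
  induction l with
  | zero => rfl
  | succ l ih => simp [toppedCount, ih]

/-- The shifted term `toppedCount l (p + 1) 0` lacks only its `p = 0` part, which is 1/(1 - X); the
words of length zero supply precisely that series. -/
theorem paramGF_tailCount : paramGF tailCount =
    X * (X * paramGF (diagonalSum twoCount 0) + paramGF tailCount) +
      paramGF fun l p => toppedCount l p 0 := by
  rw [paramGF_eq_of_param fun l p => toppedCount l p 0]
  conv_lhs => rw [paramGF_eq_of_length fun _ => rfl]
  have h : (fun l p => tailCount (l + 1) p) = fun l p =>
      ∑ i ∈ Finset.range p, twoCount l i (0 + (p - 1 - i)) + tailCount l p +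
        toppedCount l (p + 1) 0 := by
    funext l p
    rw [tailCount, sum_range_twoCount]
  rw [h, paramGF_add, paramGF_add, paramGF_sum_range]
  simp only [toppedCount_zero_zero]
  have : (PowerSeries.mk 1 : ℚ⟦X⟧) = PowerSeries.mk fun _ => ((1 : ℕ) : ℚ) := by
    ext n
    simp
  rw [this]
  ring

theorem paramGF_repeatCount : paramGF repeatCount =
    PowerSeries.mk 1 + X * (X * (X * paramGF (diagonalSum twoCount 0) + paramGF tailCount)) := by
  rw [paramGF_eq_of_length fun _ => by rw [repeatCount],
    paramGF_eq_of_param fun l p => repeatCount (l + 1) p]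
  have h : (PowerSeries.mk fun l => ((repeatCount (l + 1) 0 : ℕ) : ℚ)) = 0 := by
    ext n
    simp [repeatCount]
  rw [h, zero_add, ← paramGF_sum_range, ← paramGF_add]
  simp only [repeatCount, zero_add]

theorem avoidGF_eq : avoidGF {[1, 1, 2, 3], [1, 2, 1, 1]} = paramGF repeatCount := by
  ext n
  rw [avoidGF, coeff_mk, avoidCount_eq (counts_continuation n 0), paramGF, coeff_mk]
  simp

/-! ### Solving the functional equations -/

/-- If Xⁿ divides every `D q`, iterating `hE` shows that it divides every `E q`, and the outer
factor X in `hD` improves this to Xⁿ⁺¹. Applied to the difference between a series and its guessed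
closed form. -/
theorem eq_zero_of_recurrence {D E : ℕ → ℚ⟦X⟧} {a b : ℚ⟦X⟧} (hE : ∀ q, E q = D q + X * E (q + 1))
    (hD : ∀ q, D q = X * (X * E q + a * D q + b * ∑ j ∈ Finset.range q, D j)) (q : ℕ) :
    D q = 0 := by
  have key : ∀ n q, X ^ n ∣ D q := by
    intro n
    induction n with
    | zero => simp
    | succ n ih =>
      have hEn : ∀ m ≤ n, ∀ q, X ^ m ∣ E q := by
        intro m
        induction m with
        | zero => simp
        | succ m ihm =>
          intro hm q
          rw [hE q, pow_succ']
          refine dvd_add ?_ (mul_dvd_mul_left _ (ihm (by omega) _))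
          rw [← pow_succ']
          exact (pow_dvd_pow _ hm).trans (ih q)
      intro q
      rw [hD q, pow_succ']
      exact mul_dvd_mul_left _ (dvd_add (dvd_add ((hEn n le_rfl q).mul_left _)
        ((ih q).mul_left _)) ((Finset.dvd_sum fun j _ => ih j).mul_left _))
  ext n
  exact X_pow_dvd_iff.1 (key (n + 1) q) n (Nat.lt_succ_self n)

theorem eq_zero_of_diagonal {D E : ℕ → ℚ⟦X⟧} (hE : ∀ q, E q = D q + X * E (q + 1))
    (hD : ∀ q, D q = 0) (q : ℕ) : E q = 0 := by
  have key : ∀ n q, X ^ n ∣ E q := by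
    intro n
    induction n with
    | zero => simp
    | succ n ih =>
      intro q
      rw [hE q, hD q, zero_add, pow_succ']
      exact mul_dvd_mul_left _ (ih _)
  ext n
  exact X_pow_dvd_iff.1 (key (n + 1) q) n (Nat.lt_succ_self n)

theorem exists_catalan_composite :
    ∃ g : ℚ⟦X⟧, X ^ 2 * g ^ 2 = (1 - X) * (g - 1) := by
  -- The series `a` is X²/(1 - X), substituted below into C = 1 + zC².
  set a : ℚ⟦X⟧ := X ^ 2 * PowerSeries.mk 1 with ha
  have ha0 : constantCoeff a = 0 := by simp [ha]
  have hs : HasSubst a := HasSubst.of_constantCoeff_zero' ha0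
  set C : ℚ⟦X⟧ := catalanSeries.map (Nat.castRingHom ℚ) with hC
  have h := congrArg (substAlgHom (R := ℚ) hs)
    (congrArg (PowerSeries.map (Nat.castRingHom ℚ)) catalanSeries_sq_mul_X_add_one)
  rw [map_add, map_mul, map_pow, map_one, map_X, ← hC, map_add, map_mul, map_pow, map_one,
    substAlgHom_X] at h
  have hg : X ^ 2 * (substAlgHom hs C) ^ 2 = (1 - X) * (substAlgHom hs C - 1) := by
    linear_combination (1 - X) * h -
      X ^ 2 * (substAlgHom hs C) ^ 2 * mk_one_mul_one_sub_eq_one ℚ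
  exact ⟨_, hg⟩

/-! ### Closed forms geometric in q -/

section Solution

variable {g v w : ℚ⟦X⟧}

/-- With ratio 1 + Xg, the sum over j < q telescopes against the inhomogeneous term, and the
diagonal sum contributes the factor v = 1/(1 - X(1 + Xg)). What remains is g = 1 + X²gv, the
defining equation of g. -/
theorem bareGF_eq (hv : v * (1 - X * (1 + X * g)) = 1) (hg : X ^ 2 * g * v = g - 1) (q : ℕ) :
    paramGF (fun l p => bareCount l p q) = g * PowerSeries.mk 1 * (1 + X * g) ^ q := by
  set u : ℚ⟦X⟧ := PowerSeries.mk 1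
  rw [← sub_eq_zero]
  refine eq_zero_of_recurrence
    (D := fun q => paramGF (fun l p => bareCount l p q) - g * u * (1 + X * g) ^ q)
    (E := fun q => paramGF (diagonalSum bareCount q) - g * u * v * (1 + X * g) ^ q)
    (a := 0) (b := 1) (fun q => ?_) (fun q => ?_) q
  · linear_combination paramGF_diagonalSum bareCount q - g * u * (1 + X * g) ^ q * hv
  · have hgeom := geom_sum_mul (1 + X * g) q
    rw [Finset.sum_sub_distrib, ← Finset.mul_sum]
    linear_combination paramGF_bareCount q + u * (1 + X * g) ^ q * hg + u * hgeom

theorem sum_bareGF_eq (hv : v * (1 - X * (1 + X * g)) = 1) (hg : X ^ 2 * g * v = g - 1) (q : ℕ) :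
    X * ∑ j ∈ Finset.range q, paramGF (fun l p => bareCount l p j) =
      PowerSeries.mk 1 * ((1 + X * g) ^ q - 1) := by
  simp only [bareGF_eq hv hg]
  rw [← Finset.mul_sum]
  linear_combination PowerSeries.mk 1 * geom_sum_mul (1 + X * g) q

theorem toppedGF_eq (hv : v * (1 - X * (1 + X * g)) = 1) (hg : X ^ 2 * g * v = g - 1)
    (hw : w * (1 - X * g) = 1) (q : ℕ) :
    paramGF (fun l p => toppedCount l p q) = g * PowerSeries.mk 1 * w * (1 + X * g) ^ q := by
  have hsum := sum_bareGF_eq hv hg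
  set u : ℚ⟦X⟧ := PowerSeries.mk 1
  rw [← sub_eq_zero]
  refine eq_zero_of_recurrence
    (D := fun q => paramGF (fun l p => toppedCount l p q) - g * u * w * (1 + X * g) ^ q)
    (E := fun q => paramGF (diagonalSum toppedCount q) - g * u * w * v * (1 + X * g) ^ q)
    (a := 1) (b := 0) (fun q => ?_) (fun q => ?_) q
  · linear_combination paramGF_diagonalSum toppedCount q - g * u * w * (1 + X * g) ^ q * hv
  · linear_combination paramGF_toppedCount q + hsum q + u * w * (1 + X * g) ^ q * hg -
      u * (1 + X * g) ^ q * hw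

theorem diagonal_twoGF_eq (hv : v * (1 - X * (1 + X * g)) = 1) (hg : X ^ 2 * g * v = g - 1)
    (hw : w * (1 - X * g) = 1) :
    X ^ 2 * paramGF (diagonalSum twoCount 0) =
      (g - 1) * (PowerSeries.mk 1 * (1 + X * g * w * (2 + X * g))) := by
  have hsum := sum_bareGF_eq hv hg
  have htop := toppedGF_eq hv hg hw
  set u : ℚ⟦X⟧ := PowerSeries.mk 1
  -- The summand 2 + Xg is 1 + (1 + Xg), from the topped series at `q` and `q + 1`.
  set e : ℚ⟦X⟧ := u * (1 + X * g * w * (2 + X * g))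
  have hE : ∀ q, paramGF (diagonalSum twoCount q) - g * e * v * (1 + X * g) ^ q =
      (paramGF (fun l p => twoCount l p q) - g * e * (1 + X * g) ^ q) +
        X * (paramGF (diagonalSum twoCount (q + 1)) - g * e * v * (1 + X * g) ^ (q + 1)) := by
    intro q
    linear_combination paramGF_diagonalSum twoCount q - g * e * (1 + X * g) ^ q * hv
  have hD := eq_zero_of_recurrence
    (D := fun q => paramGF (fun l p => twoCount l p q) - g * e * (1 + X * g) ^ q)
    (E := fun q => paramGF (diagonalSum twoCount q) - g * e * v * (1 + X * g) ^ q)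
    (a := 0) (b := 0) hE fun q => by
      linear_combination paramGF_twoCount q + hsum q + e * (1 + X * g) ^ q * hg +
        X * htop q + X * htop (q + 1)
  have h0 := eq_zero_of_diagonal (E := fun q => paramGF (diagonalSum twoCount q) -
    g * e * v * (1 + X * g) ^ q) hE hD 0
  linear_combination X ^ 2 * h0 + e * hg

end Solution

end GeneratingFunctions

theorem paramGF_repeatCount_mul {g : ℚ⟦X⟧}
    (hg : PowerSeries.X ^ 2 * g ^ 2 = (1 - PowerSeries.X) * (g - 1)) :
    paramGF repeatCount * (2 * PowerSeries.X ^ 2 * (1 - PowerSeries.X) ^ 2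
        * (1 - 3 * PowerSeries.X + PowerSeries.X ^ 2)) =
      (1 - PowerSeries.X ^ 2) * (1 - PowerSeries.X) ^ 2
          * (1 - PowerSeries.X - 2 * PowerSeries.X ^ 2 * g) -
        (1 - 3 * PowerSeries.X - 2 * PowerSeries.X ^ 2 + 14 * PowerSeries.X ^ 3
          - 15 * PowerSeries.X ^ 4 + 3 * PowerSeries.X ^ 5) := by
  have hv : (1 - PowerSeries.X * (1 + PowerSeries.X * g))⁻¹ *
      (1 - PowerSeries.X * (1 + PowerSeries.X * g)) = 1 :=
    PowerSeries.inv_mul_cancel _ (by simp)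
  have hw : (1 - PowerSeries.X * g)⁻¹ * (1 - PowerSeries.X * g) = 1 :=
    PowerSeries.inv_mul_cancel _ (by simp)
  have hgv : PowerSeries.X ^ 2 * g * (1 - PowerSeries.X * (1 + PowerSeries.X * g))⁻¹ = g - 1 := by
    linear_combination (g - 1) * hv +
      (1 - PowerSeries.X * (1 + PowerSeries.X * g))⁻¹ * hg
  have hY := diagonal_twoGF_eq hv hgv hw
  have hT := paramGF_tailCount
  rw [toppedGF_eq hv hgv hw, pow_zero, mul_one] at hT
  have hG := paramGF_repeatCount
  have hu := PowerSeries.mk_one_mul_one_sub_eq_one ℚ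
  have hne : (1 - PowerSeries.X * g) ≠ 0 := right_ne_zero_of_mul_eq_one hw
  set u : ℚ⟦X⟧ := PowerSeries.mk 1
  set w := (1 - PowerSeries.X * g)⁻¹
  set Y := paramGF (diagonalSum twoCount 0)
  set T := paramGF tailCount
  set x : ℚ⟦X⟧ := PowerSeries.X
  have hY' : (1 - x * g) * (1 - x) * (x ^ 2 * Y) = (g - 1) * (1 + x * g + x ^ 2 * g ^ 2) := by
    linear_combination (1 - x * g) * (1 - x) * hY +
      (g - 1) * ((1 - x * g) + x * g * (2 + x * g) * w * (1 - x * g)) * hu +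
      (g - 1) * x * g * (2 + x * g) * hw
  have hT' : (1 - x * g) * (1 - x) ^ 2 * T = g + (g - 1) * (1 + x * g + x ^ 2 * g ^ 2) := by
    linear_combination (1 - x * g) * (1 - x) * hT + hY' + g * w * (1 - x * g) * hu + g * hw
  have hG' : (1 - x * g) * (1 - x) ^ 2 * paramGF repeatCount =
      (1 - x) * (1 - x * g) + x * (1 - x) * ((g - 1) * (1 + x * g + x ^ 2 * g ^ 2)) +
        x ^ 2 * (g + (g - 1) * (1 + x * g + x ^ 2 * g ^ 2)) := by
    linear_combination (1 - x * g) * (1 - x) ^ 2 * hG + (1 - x) * (1 - x * g) * hu +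
      x * (1 - x) * hY' + x ^ 2 * hT'
  -- After multiplication by 1 - Xg the claim is a polynomial identity in X and g modulo the
  -- quadratic for g.
  refine mul_left_cancel₀ hne ?_
  linear_combination 2 * x ^ 2 * (1 - 3 * x + x ^ 2) * hG' +
    (2 * x ^ 3 * g - 6 * x ^ 4 * g + 2 * x ^ 5 * g - 2 * x ^ 2 + 2 * x ^ 4) * hg

/-- `S` is the formal power series `√((1 - X)(1 - X - 4X²))`: a power series with rational
coefficients is determined by its square and its constant term `1`.  The equation is one between
formal Laurent series, so that the divisions by `X²` are genuine divisions in a field. -/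
theorem mainTheorem11 :
    ∃ S : ℚ⟦X⟧,
      PowerSeries.constantCoeff S = 1 ∧
      S ^ 2 = (1 - PowerSeries.X) * (1 - PowerSeries.X - 4 * PowerSeries.X ^ 2) ∧
      (avoidGF {[1, 1, 2, 3], [1, 2, 1, 1]} : ℚ⸨X⸩) =
        (((1 - PowerSeries.X ^ 2) * S : ℚ⟦X⟧) : ℚ⸨X⸩) /
            ((2 * PowerSeries.X ^ 2 * (1 - 3 * PowerSeries.X + PowerSeries.X ^ 2) : ℚ⟦X⟧) : ℚ⸨X⸩) -
          ((1 - 3 * PowerSeries.X - 2 * PowerSeries.X ^ 2 + 14 * PowerSeries.X ^ 3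
              - 15 * PowerSeries.X ^ 4 + 3 * PowerSeries.X ^ 5 : ℚ⟦X⟧) : ℚ⸨X⸩) /
            ((2 * PowerSeries.X ^ 2 * (1 - PowerSeries.X) ^ 2
              * (1 - 3 * PowerSeries.X + PowerSeries.X ^ 2) : ℚ⟦X⟧) : ℚ⸨X⸩) := by

  obtain ⟨g, hg⟩ := exists_catalan_composite
  -- This is the root from the quadratic formula g = (1 - X - S)/(2X²), with the sign that gives
  -- constant term 1.
  refine ⟨1 - PowerSeries.X - 2 * PowerSeries.X ^ 2 * g, by simp, ?_, ?_⟩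
  · linear_combination 4 * PowerSeries.X ^ 2 * hg
  have hK : (1 - 3 * PowerSeries.X + PowerSeries.X ^ 2 : ℚ⟦X⟧) ≠ 0 := fun h => by
    simpa using congrArg PowerSeries.constantCoeff h
  have hX : (1 - PowerSeries.X : ℚ⟦X⟧) ≠ 0 := fun h => by
    simpa using congrArg PowerSeries.constantCoeff h
  have h2 : (2 * PowerSeries.X ^ 2 : ℚ⟦X⟧) ≠ 0 :=
    mul_ne_zero (fun h => two_ne_zero (α := ℚ)
      (by simpa [map_ofNat] using congrArg PowerSeries.constantCoeff h))
      (pow_ne_zero _ PowerSeries.X_ne_zero)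
  have hinj := HahnSeries.ofPowerSeries_injective (Γ := ℤ) (R := ℚ)
  rw [avoidGF_eq, div_sub_div _ _ ((map_ne_zero_iff _ hinj).2 (mul_ne_zero h2 hK))
      ((map_ne_zero_iff _ hinj).2 (mul_ne_zero (mul_ne_zero h2 (pow_ne_zero _ hX)) hK)),
    eq_div_iff (mul_ne_zero ((map_ne_zero_iff _ hinj).2 (mul_ne_zero h2 hK))
      ((map_ne_zero_iff _ hinj).2 (mul_ne_zero (mul_ne_zero h2 (pow_ne_zero _ hX)) hK))),
    ← map_mul, ← map_mul, ← map_mul, ← map_mul, ← map_sub]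
  refine congrArg _ ?_
  -- Cross-multiplying the two fractions leaves this extra common factor.
  linear_combination 2 * PowerSeries.X ^ 2 * (1 - 3 * PowerSeries.X + PowerSeries.X ^ 2) *
    paramGF_repeatCount_mul hg
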